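/- Let $G=(V,E)$ be a finite simple graph and let $\beta,h\in\mathbb R$. The Ising model on $G$ assigns to each vertex the weight $e^{h}$ if its spin is $+1$ and $e^{-h}$ if its spin is $-1$, and to each edge the weight $e^{-\beta}$ if the spins of its two endpoints agree and $e^{\beta}$ if they differ. The weight $w_{\beta,h}(\sigma)$ of a configuration $\sigma:V\to\{+1,-1\}$ is the product of all these vertex and edge weights, that is, $$w_{\beta,h}(\sigma)=\exp\Big\{-\beta\sum_{uv\in E}\sigma(u)\sigma(v)+h\sum_{v\in V}\sigma(v)\Big\},$$ and the partition function is $Z_{\beta,h}(G)=\sum_{\sigma}w_{\beta,h}(\sigma)$. If $G$ has $N\ge 1$ vertices, its free energy is $F_{\beta,h}(G)=\ln (Z_{\beta,h}(G))/N$. (1) For every $\beta>0$ (the antiferromagnetic case), every $d\ge 0$, every $N\ge 1$ and every $d$-regular bipartite graph $G$ with $N$ vertices, $$\frac{\beta d}{2}\;\le\; F_{\beta,0}(G)\;\le\;\frac{\beta d}{2}+\ln 2 .$$ In particular both bounds are independent of $G$ and $N$, given $d$ and $\beta$. (2) Both bounds are asymptotically tight for families with $\beta d\to\infty$: if $(G_i)_{i\in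 I}$ is a family of non-empty finite bipartite graphs, $G_i$ being $d_i$-regular, if $\beta_i>0$ for all $i$, and if $\beta_i d_i\to\infty$ along some filter on $I$ (for instance, along a sequence), then, along the same filter, $F_{\beta_i,0}(G_i)\sim \beta_i d_i/2$ and $F_{\beta_i,0}(G_i)\sim \beta_i d_i/2+\ln 2$, where $a_i\sim b_i$ means $a_i/b_i\to1$. -/

import Mathlib

open scoped Asymptotics

/-- A system of non-negative weights on the spin set `S` for a graph with vertex set `V`:
a weight for each spin at each vertex, and a weight for each unordered pair of spins at each
edge. (Edge weights are indexed by all unordered pairs of vertices; only the values at edges of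
the graph at hand are ever used.) -/
structure WeightSystem (S V : Type*) where
  vertex : S → V → ℝ
  edge : Sym2 S → Sym2 V → ℝ
  vertex_nonneg : ∀ i v, 0 ≤ vertex i v
  edge_nonneg : ∀ p e, 0 ≤ edge p e

namespace WeightSystem

variable {S V : Type*}

/-- The weight `∏_v λ_{f(v),v} ∏_{uv ∈ E} λ_{f(u)f(v),uv}` of a configuration `f`.
For an edge `e = s(u, v)`, `e.map f = s(f u, f v)`. -/
def weight [Fintype V] (W : WeightSystem S V) (G : SimpleGraph V) [Fintype G.edgeSet]
    (f : V → S) : ℝ :=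
  (∏ v : V, W.vertex (f v) v) * ∏ e ∈ G.edgeFinset, W.edge (e.map f) e

/-- The partition function: the sum of the weights of all configurations. -/
def partitionFunction [Fintype S] [Fintype V] [DecidableEq V] (W : WeightSystem S V)
    (G : SimpleGraph V) [Fintype G.edgeSet] : ℝ :=
  ∑ f : V → S, W.weight G f

/-- The free energy `log Z / N`, with `N` the number of vertices. -/
noncomputable def freeEnergy [Fintype S] [Fintype V] [DecidableEq V] (W : WeightSystem S V)
    (G : SimpleGraph V) [Fintype G.edgeSet] : ℝ :=
  Real.log (W.partitionFunction G) / (Fintype.card V : ℝ)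

end WeightSystem

/-- The Ising weights with parameters `β` and `h`. The spin set `{+1, -1}` is `ℤˣ`;
an unordered pair of spins is diagonal exactly when the two spins agree. -/
noncomputable def isingWeights (V : Type*) (β h : ℝ) : WeightSystem ℤˣ V where
  vertex i _ := if i = 1 then Real.exp h else Real.exp (-h)
  edge p _ := if p.IsDiag then Real.exp (-β) else Real.exp β
  vertex_nonneg i v := by split_ifs <;> positivity
  edge_nonneg p e := by split_ifs <;> positivity

/-! At `h = 0` and `β ≥ 0` each edge contributes at most `exp β`, and a proper 2-colouring read as
spins attains this on all edges at once. Hence `exp (β|E|) ≤ Z ≤ 2^N exp (β|E|)`; regularity gives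
`|E| = Nd/2`, and `log Z / N` lands in a window of length `log 2`, negligible once `βd → ∞`. -/

namespace SimpleGraph

variable {V : Type*} (G : SimpleGraph V)

/-- The handshake identity for regular graphs, over the reals. -/
theorem IsRegularOfDegree.two_mul_card_edgeFinset [Fintype V] [DecidableEq V]
    [DecidableRel G.Adj] {d : ℕ} (hd : G.IsRegularOfDegree d) :
    2 * (G.edgeFinset.card : ℝ) = Fintype.card V * d := by
  have h := G.sum_degrees_eq_twice_card_edges
  rw [Finset.sum_congr rfl fun v _ => hd.degree_eq v] at h
  simp only [Finset.sum_const, Finset.card_univ, smul_eq_mul] at h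
  exact_mod_cast h.symm

/-- A bipartite graph has a spin configuration in which the endpoints of each edge differ. -/
theorem IsBipartite.exists_spin_ne (hG : G.IsBipartite) :
    ∃ f : V → ℤˣ, ∀ u v, G.Adj u v → f u ≠ f v := by
  obtain ⟨C⟩ := hG
  have hinj : Function.Injective fun c : Fin 2 => if c = 0 then (1 : ℤˣ) else -1 := by
    decide
  exact ⟨fun v => if C v = 0 then 1 else -1, fun u v huv h => C.valid huv (hinj h)⟩

end SimpleGraph

section Ising

variable {V : Type*} [Fintype V] (G : SimpleGraph V) [Fintype G.edgeSet] {β : ℝ}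

theorem isingWeights_zero_weight (f : V → ℤˣ) :
    (isingWeights V β 0).weight G f =
      ∏ e ∈ G.edgeFinset, if (e.map f).IsDiag then Real.exp (-β) else Real.exp β := by
  simp [WeightSystem.weight, isingWeights]

theorem isingWeights_zero_weight_nonneg (f : V → ℤˣ) :
    0 ≤ (isingWeights V β 0).weight G f := by
  rw [isingWeights_zero_weight]
  exact Finset.prod_nonneg fun e _ => by split_ifs <;> positivity

theorem isingWeights_zero_weight_le (hβ : 0 ≤ β) (f : V → ℤˣ) :
    (isingWeights V β 0).weight G f ≤ Real.exp (β * G.edgeFinset.card) := by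
  -- Spread `exp (β|E|)` into one factor `exp β` per edge, to compare edge by edge.
  rw [isingWeights_zero_weight, mul_comm, Real.exp_nat_mul, ← Finset.prod_const]
  refine Finset.prod_le_prod (fun e _ => by split_ifs <;> positivity) fun e _ => ?_
  split_ifs
  · exact Real.exp_le_exp.2 (by linarith)
  · exact le_rfl

theorem isingWeights_zero_weight_of_forall_ne {f : V → ℤˣ}
    (hf : ∀ u v, G.Adj u v → f u ≠ f v) :
    (isingWeights V β 0).weight G f = Real.exp (β * G.edgeFinset.card) := by
  rw [isingWeights_zero_weight, mul_comm, Real.exp_nat_mul, ← Finset.prod_const]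
  refine Finset.prod_congr rfl fun e he => ?_
  induction e with
  | _ u v =>
    rw [SimpleGraph.mem_edgeFinset, SimpleGraph.mem_edgeSet] at he
    simp [hf u v he]

variable [DecidableEq V]

theorem isingWeights_zero_partitionFunction_le (hβ : 0 ≤ β) :
    (isingWeights V β 0).partitionFunction G ≤
      2 ^ Fintype.card V * Real.exp (β * G.edgeFinset.card) := by
  refine (Finset.sum_le_card_nsmul _ _ _ fun f _ => isingWeights_zero_weight_le G hβ f).trans ?_
  simp [Fintype.card_units_int]

/-- A single term of the non-negative sum suffices: the 2-colouring. -/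
theorem SimpleGraph.IsBipartite.le_isingWeights_zero_partitionFunction (hG : G.IsBipartite) :
    Real.exp (β * G.edgeFinset.card) ≤ (isingWeights V β 0).partitionFunction G := by
  obtain ⟨f, hf⟩ := hG.exists_spin_ne
  rw [← isingWeights_zero_weight_of_forall_ne G hf]
  exact Finset.single_le_sum (f := (isingWeights V β 0).weight G)
    (fun g _ => isingWeights_zero_weight_nonneg G g) (Finset.mem_univ f)

end Ising

theorem SimpleGraph.IsBipartite.isingWeights_zero_freeEnergy_bounds
    {V : Type*} [Fintype V] [DecidableEq V] [Nonempty V]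
    {G : SimpleGraph V} [DecidableRel G.Adj] {d : ℕ} {β : ℝ}
    (hG : G.IsBipartite) (hd : G.IsRegularOfDegree d) (hβ : 0 ≤ β) :
    β * d / 2 ≤ (isingWeights V β 0).freeEnergy G ∧
      (isingWeights V β 0).freeEnergy G ≤ β * d / 2 + Real.log 2 := by
  have hN : (0 : ℝ) < Fintype.card V := by exact_mod_cast Fintype.card_pos
  have hE : β * d / 2 * Fintype.card V = β * G.edgeFinset.card := by
    linear_combination -(β / 2) * hd.two_mul_card_edgeFinset
  have hlow := hG.le_isingWeights_zero_partitionFunction (β := β)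
  have hZ := (Real.exp_pos _).trans_le hlow
  constructor
  · rw [WeightSystem.freeEnergy, le_div_iff₀ hN, hE]
    exact (Real.le_log_iff_exp_le hZ).2 hlow
  · rw [WeightSystem.freeEnergy, div_le_iff₀ hN, add_mul, hE]
    refine (Real.log_le_log hZ (isingWeights_zero_partitionFunction_le G hβ)).trans_eq ?_
    rw [Real.log_mul (by positivity) (by positivity), Real.log_pow, Real.log_exp]
    ring

/-- A function within bounded distance of a function tending to infinity is equivalent to it. -/
theorem Asymptotics.IsEquivalent.of_abs_sub_le {ι : Type*} {l : Filter ι} {u v : ι → ℝ} {C : ℝ}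
    (hv : Filter.Tendsto v l Filter.atTop) (h : ∀ i, |u i - v i| ≤ C) : u ~[l] v := by
  have hO : (u - v) =O[l] fun _ => (1 : ℝ) :=
    Asymptotics.IsBigO.of_bound C (.of_forall fun i => by simpa using h i)
  -- The constant `1` is little-o of `v` because `|v| → ∞`.
  refine hO.trans_isLittleO ((Asymptotics.isLittleO_const_left).2 (Or.inr ?_))
  exact Filter.tendsto_abs_atTop_atTop.comp hv

theorem mainTheorem4 :
    (∀ (V : Type*) [Fintype V] [DecidableEq V] [Nonempty V]
        (G : SimpleGraph V) [DecidableRel G.Adj] (d : ℕ) (β : ℝ),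
        G.IsBipartite → G.IsRegularOfDegree d → 0 < β →
        β * d / 2 ≤ (isingWeights V β 0).freeEnergy G ∧
          (isingWeights V β 0).freeEnergy G ≤ β * d / 2 + Real.log 2) ∧
    (∀ (ι : Type*) (l : Filter ι) (V : ι → Type*)
        [∀ i, Fintype (V i)] [∀ i, DecidableEq (V i)] [∀ i, Nonempty (V i)]
        (G : ∀ i, SimpleGraph (V i)) [∀ i, DecidableRel (G i).Adj] (d : ι → ℕ) (β : ι → ℝ),
        (∀ i, (G i).IsBipartite) → (∀ i, (G i).IsRegularOfDegree (d i)) → (∀ i, 0 < β i) →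
        Filter.Tendsto (fun i => β i * d i) l Filter.atTop →
        ((fun i => (isingWeights (V i) (β i) 0).freeEnergy (G i)) ~[l]
            fun i => β i * d i / 2) ∧
          ((fun i => (isingWeights (V i) (β i) 0).freeEnergy (G i)) ~[l]
            fun i => β i * d i / 2 + Real.log 2)) := by
  refine ⟨fun V _ _ _ G _ d β hG hd hβ => hG.isingWeights_zero_freeEnergy_bounds hd hβ.le, ?_⟩
  intro ι l V _ _ _ G _ d β hG hd hβ hlim
  have hb := fun i => (hG i).isingWeights_zero_freeEnergy_bounds (hd i) (hβ i).le
  have hlim2 : Filter.Tendsto (fun i => β i * d i / 2) l Filter.atTop :=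
    hlim.atTop_div_const two_pos
  -- The free energy differs from the lower bound by an amount in `[0, log 2]`, and from the upper
  -- bound by one in `[-log 2, 0]`.
  refine ⟨.of_abs_sub_le (C := Real.log 2) hlim2 fun i => ?_,
    .of_abs_sub_le (C := Real.log 2) (Filter.tendsto_atTop_add_const_right l _ hlim2)
      fun i => ?_⟩ <;>
  · rw [abs_le]
    have := Real.log_nonneg one_le_two
    constructor <;> linarith [(hb i).1, (hb i).2]
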